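/- For $\mathcal B\subseteq\mathbb R$ let $\Omega_{\mathrm{cts}}(\mathcal B)$ be the set of probability distributions on $\mathbb R$ that have a Lebesgue density and satisfy $P(\mathcal B)=1$. For $\Omega_0\subseteq\Omega_{\mathrm{cts}}(\mathcal B)$: - $\Omega_0$ *satisfies the randomization hypothesis* (for sample size $n$) if there is a group $\mathbb G$, under composition, of measurable bijections $g:\mathbb R^n\to\mathbb R^n$ such that $\Omega_0\subseteq\Omega_{\mathbb G}\subsetneq\Omega_{\mathrm{cts}}(\mathcal B)$, where $\Omega_{\mathbb G}$ is the set of $P\in\Omega_{\mathrm{cts}}(\mathcal B)$ such that $gX\stackrel{d}{=}X$ for all $g\in\mathbb G$ when $X=(X_1,\dots,X_n)$ has i.i.d. coordinates with law $P$. - $\Omega_0$ is *locally-dense* if there is $L:\mathbb N\to(0,\infty)$ such that for every $m$, all intervals $I_1,\dots,I_m\subseteq\mathcal B$ with $|I_i|<L(m)$, and every probability density $p$ that vanishes outside $\bigcup_j I_j$, there are $H\in\Omega_0$ with density $h$ and $\alpha\in(0,1]$ with $h=\alpha p$ on $\bigcup_j I_j$. Let $b_0<b_1$ be real numbers. (i)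 For every positive integer $t$ and every $\beta$ in the interior of $\{x^t : x\in[b_0,b_1]\}$, the set $\{P\in\Omega_{\mathrm{cts}}([b_0,b_1]) : \mathbb E_P[X_i^t]=\beta\}$ is locally-dense and, for every sample size $n$, does not satisfy the randomization hypothesis. (ii) For every $p\in(0,1)$ and every $q\in(b_0,b_1)$, the set $\{P\in\Omega_{\mathrm{cts}}([b_0,b_1]) : \mathbb P_P[X_i\le q]=p\}$ is locally-dense and, for every sample size $n$, does not satisfy the randomization hypothesis. -/

import Mathlib

open MeasureTheory Set

/-- The set of continuous distributions supported on `B`: probability measures on the real line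
that have a Lebesgue density and give full mass to `B`. -/
def OmegaCts (B : Set ℝ) : Set (Measure ℝ) :=
  {P | IsProbabilityMeasure P ∧ P ≪ volume ∧ P Bᶜ = 0}

/-- The joint law of `X = (X₁, …, Xₙ)` with the `Xᵢ` drawn i.i.d. from `P`. -/
noncomputable def iidLaw (n : ℕ) (P : Measure ℝ) : Measure (Fin n → ℝ) :=
  Measure.pi fun _ : Fin n => P

/-- `Ω_G`: the distributions `P` in `Ω` such that `g X` has the same law as `X` for all `g ∈ G`,
where `X = (X₁, …, Xₙ)` is an i.i.d. sample from `P`. -/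
def OmegaInv (n : ℕ) (Ω : Set (Measure ℝ)) (G : Subgroup (Equiv.Perm (Fin n → ℝ))) :
    Set (Measure ℝ) :=
  {P | P ∈ Ω ∧ ∀ g ∈ G, (iidLaw n P).map g = iidLaw n P}

/-- The null `Ω₀` satisfies the randomization hypothesis, relative to `Ω` and for i.i.d. samples of
size `n`: there is a group `G` of measurable transformations of the sample space with
`Ω₀ ⊆ Ω_G ⊊ Ω`. -/
def RandomizationHypothesis (n : ℕ) (Ω Ω₀ : Set (Measure ℝ)) : Prop :=
  ∃ G : Subgroup (Equiv.Perm (Fin n → ℝ)),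
    (∀ g ∈ G, Measurable g) ∧ Ω₀ ⊆ OmegaInv n Ω G ∧ OmegaInv n Ω G ⊂ Ω

/-- `p` is a probability density function on the real line. -/
def IsProbDensity (p : ℝ → ℝ) : Prop :=
  Measurable p ∧ (∀ x, 0 ≤ p x) ∧ ∫⁻ x, ENNReal.ofReal (p x) = 1

/-- The distribution with density `p`. -/
noncomputable def densityLaw (p : ℝ → ℝ) : Measure ℝ :=
  volume.withDensity fun x => ENNReal.ofReal (p x)

/-- `Ω₀ ⊆ OmegaCts B` is locally-dense: there is `L : ℕ → (0, ∞)` such that for all intervals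
`I₁, …, Iₘ` in `B` of length less than `L m`, every density `p` supported on their union is
matched there, up to a scaling `a ∈ (0, 1]`, by a density `h` of some member of `Ω₀`.
The intervals may be open, closed or half-open, and may overlap. -/
def LocallyDense (B : Set ℝ) (Ω₀ : Set (Measure ℝ)) : Prop :=
  Ω₀ ⊆ OmegaCts B ∧
  ∃ L : ℕ → ℝ, (∀ m, 0 < L m) ∧
    ∀ (m : ℕ) (I : Fin m → Set ℝ),
      (∀ i, (I i).OrdConnected ∧ I i ⊆ B ∧ volume (I i) < ENNReal.ofReal (L m)) →
      ∀ p : ℝ → ℝ, IsProbDensity p → (∀ x, x ∉ ⋃ i, I i → p x = 0) →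
        ∃ h : ℝ → ℝ, IsProbDensity h ∧ densityLaw h ∈ Ω₀ ∧
          ∃ a : ℝ, 0 < a ∧ a ≤ 1 ∧ ∀ x ∈ ⋃ i, I i, h x = a * p x

/-- The null hypothesis that the `t`-th moment equals `β`. -/
def momentNull (B : Set ℝ) (t : ℕ) (β : ℝ) : Set (Measure ℝ) :=
  {P | P ∈ OmegaCts B ∧ ∫ x, x ^ t ∂P = β}

/-- The null hypothesis that `ℙ[Xᵢ ≤ q] = p`. -/
def quantileNull (B : Set ℝ) (p q : ℝ) : Set (Measure ℝ) :=
  {P | P ∈ OmegaCts B ∧ P.real (Iic q) = p}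

/-! Local density rules out the randomization hypothesis: if every member of `Ω₀` is `G`-invariant,
so is every `P` in `OmegaCts B`, and the inclusion cannot be strict. Invariance under `g` is tested
on pieces: grid cells for a point and for its preimage under `g⁻¹` give a countable cover. On one
piece, a set and its `g`-preimage both lie in `V ^ n`, with `V` a union of `2n` short intervals.
Some `Q ∈ Ω₀` equals `c • P` on `V`, so the laws of the samples differ there by the factor `c ^ n`,
which cancels.

Both nulls fix the mean of a bounded function. A density on a small set `U` is mixed with one living
off `U` whose mean lies strictly across `β`; the weight is chosen to hit `β`
(`locallyDense_integral_eq`). -/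

theorem Measure.pi_const_smul {ι α : Type*} [Fintype ι] [MeasurableSpace α] (μ : Measure α)
    [IsFiniteMeasure μ] {c : ENNReal} (hc : c ≠ ⊤) :
    Measure.pi (fun _ : ι => c • μ) = c ^ Fintype.card ι • Measure.pi fun _ : ι => μ := by
  have : IsFiniteMeasure (c • μ) := Measure.smul_finite μ hc
  refine Measure.pi_eq fun s _ => ?_
  simp [Measure.pi_pi, Finset.prod_mul_distrib]

theorem iidLaw_apply_of_restrict_eq_smul {n : ℕ} {P Q : Measure ℝ} [IsFiniteMeasure P]
    [IsFiniteMeasure Q] {V : Set ℝ} {c : ENNReal} (hc : c ≠ ⊤)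
    (h : Q.restrict V = c • P.restrict V) {E : Set (Fin n → ℝ)} (hE : E ⊆ univ.pi fun _ => V) :
    iidLaw n Q E = c ^ n * iidLaw n P E := by
  have key : (iidLaw n Q).restrict (univ.pi fun _ => V)
      = c ^ n • (iidLaw n P).restrict (univ.pi fun _ => V) := by
    unfold iidLaw
    rw [Measure.restrict_pi_pi, Measure.restrict_pi_pi, h, Measure.pi_const_smul _ hc,
      Fintype.card_fin]
  have := congrArg (fun μ => μ E) key
  simpa [Measure.restrict_eq_self _ hE] using this

theorem densityLaw_restrict {p : ℝ → ℝ} {V : Set ℝ} (hV : MeasurableSet V) :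
    (densityLaw p).restrict V = (volume.restrict V).withDensity fun x => ENNReal.ofReal (p x) :=
  restrict_withDensity hV _

theorem IsProbDensity.isProbabilityMeasure {p : ℝ → ℝ} (hp : IsProbDensity p) :
    IsProbabilityMeasure (densityLaw p) :=
  ⟨by rw [densityLaw, withDensity_apply _ MeasurableSet.univ, setLIntegral_univ, hp.2.2]⟩

/-- A continuous distribution conditioned on a measurable set of positive mass has a density that
vanishes off that set. -/
theorem exists_isProbDensity_restrict_eq {P : Measure ℝ} [IsProbabilityMeasure P]
    (hP : P ≪ volume) {U : Set ℝ} (hU : MeasurableSet U) (hPU : P U ≠ 0) :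
    ∃ p, IsProbDensity p ∧ (∀ x, x ∉ U → p x = 0) ∧ densityLaw p = (P U)⁻¹ • P.restrict U := by
  have hac : (P U)⁻¹ • P.restrict U ≪ volume :=
    (Measure.smul_absolutelyContinuous.trans Measure.absolutelyContinuous_restrict).trans hP
  have hfin : IsFiniteMeasure ((P U)⁻¹ • P.restrict U) :=
    Measure.smul_finite _ (ENNReal.inv_ne_top.2 hPU)
  set Q := (P U)⁻¹ • P.restrict U with hQ
  have hlaw : densityLaw (U.indicator fun x => (Q.rnDeriv volume x).toReal) = Q := by
    have h1 : densityLaw (U.indicator fun x => (Q.rnDeriv volume x).toReal)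
        = volume.withDensity (U.indicator (Q.rnDeriv volume)) := by
      refine withDensity_congr_ae ?_
      filter_upwards [Q.rnDeriv_lt_top volume] with x hx
      by_cases hxU : x ∈ U <;> simp [hxU, hx.ne]
    rw [h1, withDensity_indicator hU, ← restrict_withDensity hU, Measure.withDensity_rnDeriv_eq _ _ hac,
      hQ, Measure.restrict_smul, Measure.restrict_restrict hU, inter_self]
  refine ⟨U.indicator fun x => (Q.rnDeriv volume x).toReal, ⟨?_, ?_, ?_⟩, ?_, hlaw⟩
  · exact (Measure.measurable_rnDeriv _ _).ennreal_toReal.indicator hU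
  · exact fun x => indicator_nonneg (fun _ _ => ENNReal.toReal_nonneg) x
  · have := congrArg (fun μ => μ univ) hlaw
    simp only [densityLaw, withDensity_apply _ MeasurableSet.univ, setLIntegral_univ] at this
    rw [this, hQ]
    simp [ENNReal.inv_mul_cancel hPU (measure_ne_top P U)]
  · exact fun x hx => indicator_of_notMem hx _

/-! ### Local density excludes the randomization hypothesis -/

/-- Local density is applied to `P` conditioned on the chosen cells within `B`; the part of the
cells outside `B` is null for both measures. The mesh `δ` depends only on `m`, so one grid serves
all choices of cells. -/
theorem LocallyDense.exists_forall_proportional {B : Set ℝ} {Ω₀ : Set (Measure ℝ)}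
    (hB : B.OrdConnected) (h : LocallyDense B Ω₀) (m : ℕ) :
    ∃ δ : ℝ, 0 < δ ∧ ∀ z : Fin m → ℤ, ∀ P ∈ OmegaCts B,
      P (⋃ k, Icc (z k * δ) ((z k + 1) * δ)) ≠ 0 →
      ∃ Q ∈ Ω₀, ∃ c : ENNReal, c ≠ 0 ∧ c ≠ ⊤ ∧
        Q.restrict (⋃ k, Icc (z k * δ) ((z k + 1) * δ))
          = c • P.restrict (⋃ k, Icc (z k * δ) ((z k + 1) * δ)) := by
  obtain ⟨hsub, L, hL, H⟩ := h
  refine ⟨L m / 2, half_pos (hL m), fun z P hP hPV => ?_⟩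
  obtain ⟨hprob, hac, hPB⟩ := hP
  set δ := L m / 2
  set V := ⋃ k, Icc (z k * δ) ((z k + 1) * δ) with hVdef
  have hBm : MeasurableSet B := hB.measurableSet
  have hV : MeasurableSet V := MeasurableSet.iUnion fun _ => measurableSet_Icc
  have hUV : ⋃ k, Icc (z k * δ) ((z k + 1) * δ) ∩ B = V ∩ B := by rw [hVdef, iUnion_inter]
  have hU : MeasurableSet (V ∩ B) := hV.inter hBm
  have restrict_eq : ∀ ν : Measure ℝ, ν Bᶜ = 0 → ν.restrict V = ν.restrict (V ∩ B) := by
    intro ν hν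
    refine Measure.restrict_congr_set ?_
    have hBae : ∀ᵐ x ∂ν, x ∈ B := hν
    filter_upwards [hBae] with x hx
    exact propext ⟨fun hxV => ⟨hxV, hx⟩, fun hxV => hxV.1⟩
  have hPU : P (V ∩ B) ≠ 0 := by
    have := congrArg (fun μ => μ univ) (restrict_eq P hPB)
    simp only [Measure.restrict_apply_univ] at this
    rwa [← this]
  obtain ⟨p, hp, hp0, hplaw⟩ := exists_isProbDensity_restrict_eq hac hU hPU
  obtain ⟨f, hf, hfΩ, a, ha, -, hfa⟩ := H m (fun k => Icc (z k * δ) ((z k + 1) * δ) ∩ B)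
    (fun k => ⟨ordConnected_Icc.inter hB, inter_subset_right,
      (measure_mono inter_subset_left).trans_lt (by
        rw [Real.volume_Icc]
        refine (ENNReal.ofReal_lt_ofReal_iff (hL m)).2 ?_
        have := half_lt_self (hL m)
        simp only [δ]
        linarith)⟩) p hp (by rwa [hUV])
  rw [hUV] at hfa
  refine ⟨densityLaw f, hfΩ, ENNReal.ofReal a * (P (V ∩ B))⁻¹, ?_, ?_, ?_⟩
  · simp [ha, measure_ne_top]
  · exact ENNReal.mul_ne_top ENNReal.ofReal_ne_top (ENNReal.inv_ne_top.2 hPU)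
  · rw [restrict_eq _ (hsub hfΩ).2.2, restrict_eq P hPB]
    calc (densityLaw f).restrict (V ∩ B)
        = ENNReal.ofReal a • (densityLaw p).restrict (V ∩ B) := by
          rw [densityLaw_restrict hU, densityLaw_restrict hU,
            ← withDensity_smul _ hp.1.ennreal_ofReal]
          refine withDensity_congr_ae ?_
          filter_upwards [ae_restrict_mem hU] with x hx
          simp [hfa x hx, ENNReal.ofReal_mul ha.le]
      _ = _ := by
          rw [hplaw, Measure.restrict_smul, Measure.restrict_restrict hU, inter_self, smul_smul]

theorem LocallyDense.not_randomizationHypothesis {B : Set ℝ} {Ω₀ : Set (Measure ℝ)}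
    (hB : B.OrdConnected) (h : LocallyDense B Ω₀) (n : ℕ) :
    ¬ RandomizationHypothesis n (OmegaCts B) Ω₀ := by
  rintro ⟨G, hG, hsub, hss⟩
  refine hss.2 fun P hP => ⟨hP, fun g hg => ?_⟩
  have hprob : IsProbabilityMeasure P := hP.1
  have hgm := hG g hg
  have hgm' := hG g⁻¹ (inv_mem hg)
  rcases Nat.eq_zero_or_pos n with rfl | hn
  · have : (g : (Fin 0 → ℝ) → Fin 0 → ℝ) = id := Subsingleton.elim _ _
    rw [this, Measure.map_id]
  -- `n` intervals for the sides of the cell of a point, `n` for the cell of its preimage.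
  obtain ⟨δ, hδ, H⟩ := h.exists_forall_proportional hB (n + n)
  set K : (Fin n → ℤ) → Set (Fin n → ℝ) :=
    fun z => univ.pi fun k => Icc (z k * δ) ((z k + 1) * δ) with hK
  have hKm : ∀ z, MeasurableSet (K z) := fun z => MeasurableSet.univ_pi fun _ => measurableSet_Icc
  have hmem : ∀ x : Fin n → ℝ, x ∈ K fun k => ⌊x k / δ⌋ := by
    intro x k _
    exact ⟨(le_div_iff₀ hδ).1 (Int.floor_le _), ((div_lt_iff₀ hδ).1 (Int.lt_floor_add_one _)).le⟩
  have hcover : ⋃ ij : (Fin n → ℤ) × (Fin n → ℤ), K ij.2 ∩ ⇑g⁻¹ ⁻¹' K ij.1 = univ :=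
    eq_univ_of_forall fun x => mem_iUnion.2 ⟨(_, _), hmem x, hmem (g⁻¹ x)⟩
  refine (Measure.ext_iff_of_iUnion_eq_univ hcover).2 ?_
  rintro ⟨i, j⟩
  ext C hC
  rw [Measure.restrict_apply hC, Measure.restrict_apply hC]
  have hS : MeasurableSet (C ∩ (K j ∩ ⇑g⁻¹ ⁻¹' K i)) := hC.inter ((hKm j).inter (hgm' (hKm i)))
  rw [Measure.map_apply hgm hS]
  set S := C ∩ (K j ∩ ⇑g⁻¹ ⁻¹' K i) with hSdef
  set z : Fin (n + n) → ℤ := Fin.append i j with hz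
  set V := ⋃ k, Icc (z k * δ) ((z k + 1) * δ) with hV
  have hSV : S ⊆ univ.pi fun _ => V := by
    intro x hx k _
    refine mem_iUnion.2 ⟨Fin.natAdd n k, ?_⟩
    rw [hz, Fin.append_right]
    exact hx.2.1 k trivial
  have hgSV : g ⁻¹' S ⊆ univ.pi fun _ => V := by
    intro x hx k _
    refine mem_iUnion.2 ⟨Fin.castAdd n k, ?_⟩
    have hxi : g⁻¹ (g x) ∈ K i := hx.2.2
    rw [show g⁻¹ (g x) = x from g.symm_apply_apply x] at hxi
    rw [hz, Fin.append_left]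
    exact hxi k trivial
  -- Conditioning on `V` needs positive mass; otherwise `V ^ n` is null, since `n > 0`.
  by_cases hPV : P V = 0
  · have h0 : iidLaw n P (univ.pi fun _ => V) = 0 := by
      rw [iidLaw, Measure.pi_pi]
      simp [hPV, hn.ne']
    rw [measure_mono_null hSV h0, measure_mono_null hgSV h0]
  · obtain ⟨Q, hQ, c, hc0, hct, hQP⟩ := H z P hP hPV
    obtain ⟨hQΩ, hQinv⟩ := hsub hQ
    have : IsProbabilityMeasure Q := hQΩ.1
    have e : iidLaw n Q (g ⁻¹' S) = iidLaw n Q S := by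
      rw [← Measure.map_apply hgm hS, hQinv g hg]
    rw [iidLaw_apply_of_restrict_eq_smul hct hQP hSV,
      iidLaw_apply_of_restrict_eq_smul hct hQP hgSV] at e
    exact (ENNReal.mul_right_inj (pow_ne_zero n hc0) (ENNReal.pow_ne_top hct)).1 e

/-! ### Local density of mean constraints -/

/-- Strictness on the side of `v` is what keeps the weight of `u` positive. -/
theorem exists_convexCombination_eq {u v β : ℝ} (h : v < β ∧ β ≤ u ∨ u ≤ β ∧ β < v) :
    ∃ a, 0 < a ∧ a ≤ 1 ∧ a * u + (1 - a) * v = β := by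
  refine ⟨(β - v) / (u - v), ?_⟩
  rcases h with ⟨h1, h2⟩ | ⟨h1, h2⟩
  · have : 0 < u - v := by linarith
    refine ⟨div_pos (by linarith) this, (div_le_one this).2 (by linarith), ?_⟩
    field_simp
    ring
  · have : 0 < v - u := by linarith
    refine ⟨div_pos_of_neg_of_neg (by linarith) (by linarith),
      (div_le_one_of_neg (by linarith)).2 (by linarith), ?_⟩
    have : u - v ≠ 0 := sub_ne_zero.2 (by linarith)
    field_simp
    ring

theorem densityLaw_mix {p r : ℝ → ℝ} (hp : IsProbDensity p) (hr : IsProbDensity r) {a : ℝ}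
    (ha : 0 ≤ a) (ha' : a ≤ 1) :
    densityLaw (fun x => a * p x + (1 - a) * r x)
      = ENNReal.ofReal a • densityLaw p + ENNReal.ofReal (1 - a) • densityLaw r := by
  unfold densityLaw
  rw [← withDensity_smul _ hp.1.ennreal_ofReal, ← withDensity_smul _ hr.1.ennreal_ofReal,
    ← withDensity_add_left (hp.1.ennreal_ofReal.const_smul _)]
  congr 1
  ext x
  simp [ENNReal.ofReal_add (mul_nonneg ha (hp.2.1 x)) (mul_nonneg (sub_nonneg.2 ha') (hr.2.1 x)),
    ENNReal.ofReal_mul ha, ENNReal.ofReal_mul (sub_nonneg.2 ha')]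

theorem IsProbDensity.mix {p r : ℝ → ℝ} (hp : IsProbDensity p) (hr : IsProbDensity r) {a : ℝ}
    (ha : 0 ≤ a) (ha' : a ≤ 1) : IsProbDensity fun x => a * p x + (1 - a) * r x := by
  refine ⟨(hp.1.const_mul a).add (hr.1.const_mul (1 - a)), fun x =>
    add_nonneg (mul_nonneg ha (hp.2.1 x)) (mul_nonneg (sub_nonneg.2 ha') (hr.2.1 x)), ?_⟩
  have h := congrArg (fun μ => μ univ) (densityLaw_mix hp hr ha ha')
  have := hp.isProbabilityMeasure
  have := hr.isProbabilityMeasure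
  simp only [Measure.add_apply, Measure.smul_apply, measure_univ, smul_eq_mul, mul_one] at h
  rw [← ENNReal.ofReal_add ha (sub_nonneg.2 ha'), densityLaw,
    withDensity_apply _ MeasurableSet.univ, setLIntegral_univ] at h
  simpa using h

theorem IsProbDensity.densityLaw_mem_omegaCts {p : ℝ → ℝ} {B : Set ℝ} (hp : IsProbDensity p)
    (hB : MeasurableSet B) (h : ∀ x, x ∉ B → p x = 0) : densityLaw p ∈ OmegaCts B := by
  refine ⟨hp.isProbabilityMeasure, withDensity_absolutelyContinuous _ _, ?_⟩
  rw [densityLaw, withDensity_apply _ hB.compl, setLIntegral_congr_fun (g := 0) hB.compl]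
  · simp
  · exact fun x hx => by simp [h x hx]

/-- The uniform density on a measurable set of positive finite volume. -/
theorem exists_isProbDensity_uniform {J : Set ℝ} (hJ : MeasurableSet J) (h0 : volume J ≠ 0)
    (ht : volume J ≠ ⊤) : ∃ r, IsProbDensity r ∧ ∀ x, x ∉ J → r x = 0 := by
  refine ⟨J.indicator fun _ => (volume J).toReal⁻¹, ⟨measurable_const.indicator hJ,
    fun x => indicator_nonneg (fun _ _ => by positivity) x, ?_⟩, fun x hx => indicator_of_notMem hx _⟩
  have : (fun x => ENNReal.ofReal (J.indicator (fun _ => (volume J).toReal⁻¹) x))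
      = J.indicator fun _ => (volume J)⁻¹ := by
    ext x
    by_cases hx : x ∈ J
    · simp [hx, ENNReal.ofReal_inv_of_pos (ENNReal.toReal_pos h0 ht), ENNReal.ofReal_toReal ht]
    · simp [hx]
  rw [this, lintegral_indicator_const hJ, ENNReal.inv_mul_cancel h0 ht]

theorem integrable_of_mem_omegaCts {B : Set ℝ} {φ : ℝ → ℝ} (hφ : Measurable φ) {M : ℝ}
    (hM : ∀ x ∈ B, |φ x| ≤ M) {P : Measure ℝ} (hP : P ∈ OmegaCts B) : Integrable φ P := by
  have := hP.1
  have hae : ∀ᵐ x ∂P, x ∈ B := hP.2.2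
  exact Integrable.of_bound hφ.aestronglyMeasurable M (hae.mono hM)

/-- The distributions on `B` under which a bounded function `φ` has mean `β` are locally-dense, as
soon as `φ` takes values below and above `β` on sets of positive volume. -/
theorem locallyDense_integral_eq {B : Set ℝ} (hB : B.OrdConnected) (hBfin : volume B ≠ ⊤)
    {φ : ℝ → ℝ} (hφ : Measurable φ) {M : ℝ} (hM : ∀ x ∈ B, |φ x| ≤ M) {β : ℝ}
    (hlt : volume (B ∩ {x | φ x < β}) ≠ 0) (hgt : volume (B ∩ {x | β < φ x}) ≠ 0) :
    LocallyDense B {P | P ∈ OmegaCts B ∧ ∫ x, φ x ∂P = β} := by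
  have hBm : MeasurableSet B := hB.measurableSet
  set v := min (volume (B ∩ {x | φ x < β})) (volume (B ∩ {x | β < φ x})) with hv
  have hv0 : v ≠ 0 := (lt_min (pos_iff_ne_zero.2 hlt) (pos_iff_ne_zero.2 hgt)).ne'
  have hvt : v ≠ ⊤ :=
    ((min_le_left _ _).trans_lt ((measure_mono inter_subset_left).trans_lt hBfin.lt_top)).ne
  have hvpos : 0 < v.toReal := ENNReal.toReal_pos hv0 hvt
  -- With `m + 1`, the total length stays strictly below `v`, also for `m = 0`, so `U` cannot
  -- exhaust either side of `β`.
  refine ⟨fun P hP => hP.1, fun m => v.toReal / (m + 1), fun m => by positivity, ?_⟩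
  intro m I hI p hp hpI
  set U := ⋃ i, I i with hUdef
  have hU : MeasurableSet U := MeasurableSet.iUnion fun i => (hI i).1.measurableSet
  have hUB : U ⊆ B := iUnion_subset fun i => (hI i).2.1
  have hUv : volume U < v := by
    calc volume U ≤ ∑ i, volume (I i) := measure_iUnion_fintype_le _ _
      _ ≤ ∑ _i : Fin m, ENNReal.ofReal (v.toReal / (m + 1)) :=
          Finset.sum_le_sum fun i _ => (hI i).2.2.le
      _ = ENNReal.ofReal (m * (v.toReal / (m + 1))) := by
          rw [ENNReal.ofReal_mul (by positivity)]
          simp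
      _ < ENNReal.ofReal v.toReal := by
          refine (ENNReal.ofReal_lt_ofReal_iff hvpos).2 ?_
          rw [← mul_div_assoc, div_lt_iff₀ (by positivity)]
          linarith
      _ = v := ENNReal.ofReal_toReal hvt
  have hpΩ : densityLaw p ∈ OmegaCts B :=
    hp.densityLaw_mem_omegaCts hBm fun x hx => hpI x fun hxU => hx (hUB hxU)
  have hr : ∀ J ⊆ B, MeasurableSet J → v ≤ volume J → ∃ r, IsProbDensity r ∧
      (∀ x ∈ U, r x = 0) ∧ densityLaw r ∈ OmegaCts B ∧ densityLaw r Jᶜ = 0 := by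
    intro J hJB hJ hvJ
    have hpos : volume (J \ U) ≠ 0 := by
      refine (lt_of_lt_of_le (tsub_pos_of_lt (hUv.trans_le hvJ)) le_measure_sdiff).ne'
    obtain ⟨r, hr, hr0⟩ := exists_isProbDensity_uniform (hJ.diff hU) hpos
      ((measure_mono (sdiff_subset.trans hJB)).trans_lt hBfin.lt_top).ne
    exact ⟨r, hr, fun x hx => hr0 x fun h => h.2 hx,
      hr.densityLaw_mem_omegaCts hBm fun x hx => hr0 x fun h => hx (hJB h.1),
      (hr.densityLaw_mem_omegaCts hJ fun x hx => hr0 x fun h => hx h.1).2.2⟩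
  have hmix : ∃ r, IsProbDensity r ∧ (∀ x ∈ U, r x = 0) ∧ densityLaw r ∈ OmegaCts B ∧
      ((∫ x, φ x ∂densityLaw r < β ∧ β ≤ ∫ x, φ x ∂densityLaw p) ∨
        (∫ x, φ x ∂densityLaw p ≤ β ∧ β < ∫ x, φ x ∂densityLaw r)) := by
    rcases le_total β (∫ x, φ x ∂densityLaw p) with hβ | hβ
    · obtain ⟨r, hrd, hrU, hrΩ, hrJ⟩ := hr _ inter_subset_left
        (hBm.inter (measurableSet_lt hφ measurable_const)) (min_le_left _ _)
      have := hrd.isProbabilityMeasure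
      -- The mean is at most the value at some point of the carrier, hence strictly below `β`.
      obtain ⟨x, hx, hle⟩ :=
        exists_notMem_null_integral_le (integrable_of_mem_omegaCts hφ hM hrΩ) hrJ
      exact ⟨r, hrd, hrU, hrΩ, .inl ⟨hle.trans_lt (not_not.1 hx).2, hβ⟩⟩
    · obtain ⟨r, hrd, hrU, hrΩ, hrJ⟩ := hr _ inter_subset_left
        (hBm.inter (measurableSet_lt measurable_const hφ)) (min_le_right _ _)
      have := hrd.isProbabilityMeasure
      obtain ⟨x, hx, hle⟩ :=
        exists_notMem_null_le_integral (integrable_of_mem_omegaCts hφ hM hrΩ) hrJ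
      exact ⟨r, hrd, hrU, hrΩ, .inr ⟨hβ, lt_of_lt_of_le (not_not.1 hx).2 hle⟩⟩
  obtain ⟨r, hrd, hrU, hrΩ, hor⟩ := hmix
  obtain ⟨a, ha, ha', hab⟩ := exists_convexCombination_eq hor
  have hmd := hp.mix hrd ha.le ha'
  refine ⟨_, hmd, ⟨⟨hmd.isProbabilityMeasure, withDensity_absolutelyContinuous _ _, ?_⟩, ?_⟩,
    a, ha, ha', fun x hx => by simp [hrU x hx]⟩
  · rw [densityLaw_mix hp hrd ha.le ha']
    simp [hpΩ.2.2, hrΩ.2.2]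
  · rw [densityLaw_mix hp hrd ha.le ha', integral_add_measure
      ((integrable_of_mem_omegaCts hφ hM hpΩ).smul_measure ENNReal.ofReal_ne_top)
      ((integrable_of_mem_omegaCts hφ hM hrΩ).smul_measure ENNReal.ofReal_ne_top),
      integral_smul_measure, integral_smul_measure, ENNReal.toReal_ofReal ha.le,
      ENNReal.toReal_ofReal (sub_nonneg.2 ha')]
    simpa using hab

/-- Even if the given point is an endpoint, it is a limit of interior points, so `O` meets `Ioo a
b`. -/
theorem volume_Icc_inter_ne_zero {a b : ℝ} (hab : a < b) {O : Set ℝ} (hO : IsOpen O)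
    (h : (Icc a b ∩ O).Nonempty) : volume (Icc a b ∩ O) ≠ 0 := by
  obtain ⟨x, hx, hxO⟩ := h
  rw [← closure_Ioo hab.ne] at hx
  obtain ⟨y, hyO, hy⟩ := mem_closure_iff.1 hx O hO hxO
  have : 0 < volume (Ioo a b ∩ O) := (isOpen_Ioo.inter hO).measure_pos _ ⟨y, hy, hyO⟩
  exact (this.trans_le (measure_mono (inter_subset_inter_left _ Ioo_subset_Icc_self))).ne'

theorem locallyDense_momentNull {b₀ b₁ : ℝ} (hb : b₀ < b₁) {t : ℕ} {β : ℝ}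
    (hβ : β ∈ interior ((fun x : ℝ => x ^ t) '' Icc b₀ b₁)) :
    LocallyDense (Icc b₀ b₁) (momentNull (Icc b₀ b₁) t β) := by
  have hcont : Continuous fun x : ℝ => x ^ t := continuous_pow t
  obtain ⟨M, hM⟩ := isCompact_Icc.exists_bound_of_continuousOn (hcont.continuousOn (s := Icc b₀ b₁))
  obtain ⟨l, u, hlu, hsub⟩ := mem_nhds_iff_exists_Ioo_subset.1 (mem_interior_iff_mem_nhds.1 hβ)
  obtain ⟨y, hy, hyβ⟩ := exists_between hlu.1
  obtain ⟨w, hw, hwu⟩ := exists_between hlu.2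
  obtain ⟨x, hx, hxy⟩ := hsub ⟨hy, hyβ.trans hlu.2⟩
  obtain ⟨x', hx', hxw⟩ := hsub ⟨hlu.1.trans hw, hwu⟩
  exact locallyDense_integral_eq ordConnected_Icc measure_Icc_lt_top.ne hcont.measurable hM
    (volume_Icc_inter_ne_zero hb (isOpen_lt hcont continuous_const) ⟨x, hx, hxy.trans_lt hyβ⟩)
    (volume_Icc_inter_ne_zero hb (isOpen_lt continuous_const hcont) ⟨x', hx', hw.trans_eq hxw.symm⟩)

theorem locallyDense_quantileNull {b₀ b₁ p q : ℝ} (hp : p ∈ Ioo (0 : ℝ) 1)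
    (hq : q ∈ Ioo b₀ b₁) : LocallyDense (Icc b₀ b₁) (quantileNull (Icc b₀ b₁) p q) := by
  have hb : b₀ < b₁ := hq.1.trans hq.2
  have heq : quantileNull (Icc b₀ b₁) p q = {P | P ∈ OmegaCts (Icc b₀ b₁) ∧
      ∫ x, (Iic q).indicator (1 : ℝ → ℝ) x ∂P = p} := by
    simp only [quantileNull, integral_indicator_one measurableSet_Iic]
  rw [heq]
  refine locallyDense_integral_eq (M := 1) ordConnected_Icc measure_Icc_lt_top.ne
    (measurable_one.indicator measurableSet_Iic) (fun x _ => ?_) ?_ ?_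
  · by_cases hx : x ∈ Iic q <;> simp [hx]
  -- Right of `q` the indicator is `0 < p`; left of it, `1 > p`.
  · have h := volume_Icc_inter_ne_zero hb (isOpen_Ioi (a := q)) ⟨b₁, right_mem_Icc.2 hb.le, hq.2⟩
    refine fun h0 => h (measure_mono_null (inter_subset_inter_right _ fun x hx => ?_) h0)
    have hx' : ¬ x ≤ q := not_le.2 hx
    simpa [indicator, hx'] using hp.1
  · have h := volume_Icc_inter_ne_zero hb (isOpen_Iio (a := q)) ⟨b₀, left_mem_Icc.2 hb.le, hq.1⟩
    refine fun h0 => h (measure_mono_null (inter_subset_inter_right _ fun x hx => ?_) h0)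
    have hx' : x ≤ q := le_of_lt hx
    simpa [indicator, hx'] using hp.2

theorem proposition9 (b₀ b₁ : ℝ) (hb : b₀ < b₁) :
    (∀ t : ℕ, 0 < t → ∀ β ∈ interior ((fun x : ℝ => x ^ t) '' Icc b₀ b₁),
      LocallyDense (Icc b₀ b₁) (momentNull (Icc b₀ b₁) t β) ∧
      ∀ n : ℕ, ¬ RandomizationHypothesis n (OmegaCts (Icc b₀ b₁))
        (momentNull (Icc b₀ b₁) t β)) ∧
    (∀ p ∈ Ioo (0 : ℝ) 1, ∀ q ∈ Ioo b₀ b₁,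
      LocallyDense (Icc b₀ b₁) (quantileNull (Icc b₀ b₁) p q) ∧
      ∀ n : ℕ, ¬ RandomizationHypothesis n (OmegaCts (Icc b₀ b₁))
        (quantileNull (Icc b₀ b₁) p q)) :=
  ⟨fun _ _ _ hβ => ⟨locallyDense_momentNull hb hβ,
      (locallyDense_momentNull hb hβ).not_randomizationHypothesis ordConnected_Icc⟩,
    fun _ hp _ hq => ⟨locallyDense_quantileNull hp hq,
      (locallyDense_quantileNull hp hq).not_randomizationHypothesis ordConnected_Icc⟩⟩
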